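/- **Theorem (dressing matrix for multiple zeros).** Let $\sigma_3=\mathrm{diag}(1,-1)$, and let $\mathbb C_{13}$ and $\mathbb C_{24}$ be the unions of the open first and third, respectively second and fourth, quadrants of $\mathbb C$. The space and time variables $x,t$ are fixed and suppressed. Let $\mathbf P=\mathbf P_+$ be a $2\times2$ matrix function holomorphic on $\mathbb C_{13}$ with $\mathbf P(-\zeta)=\sigma_3\mathbf P(\zeta)\sigma_3$, and let $\mathbf P_-^{-1}$ be the function on $\mathbb C_{24}$ with $\mathbf P_-^{-1}(\zeta)=\mathbf P(\zeta^*)^\dagger$. Let $\zeta_1,\dots,\zeta_r\in\mathbb C_{13}$ be such that $\zeta_i\ne\pm\zeta_k$ for $i\neq k$, let $n_1,\dots,n_r\ge 0$ be integers, $N=\sum_i n_i$, and suppose that $$\det\mathbf P(\zeta)=\prod_{i=1}^r(\zeta^2-\zeta_i^2)^{n_i}\,\rho(\zeta)\qquad(\zeta\in\mathbb C_{13})$$ with $\rho$ holomorphic and without zeros on $\mathbb C_{13}$. For each $i$ let $|v_i\rangle(\zeta)$ be a vector function that is analytic at $\zeta_i$, with $|v_i\rangle(\zeta_i)\ne0$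 and $\mathbf P(\zeta)|v_i\rangle(\zeta)=O((\zeta-\zeta_i)^{n_i})$ as $\zeta\to\zeta_i$; put $\langle v_i|(\lambda)=(|v_i\rangle(\lambda^*))^\dagger$. A *dressing matrix* is a matrix function $\Gamma(\zeta)$, holomorphic off the points $\pm\zeta_i^*$, such that $\Gamma(\zeta)\to I$ as $\zeta\to\infty$; $\Gamma(\zeta)\Gamma(\zeta^*)^\dagger=I$ (off $\pm\zeta_i,\pm\zeta_i^*$), and $\Gamma(-\zeta)=\sigma_3\Gamma(\zeta)\sigma_3$ and $\det\Gamma(\zeta)=\prod_i\big(\tfrac{\zeta^2-\zeta_i^2}{\zeta^2-\zeta_i^{*2}}\big)^{n_i}$ (off $\pm\zeta_i^*$); and such that $\Gamma$ cancels all zeros: $\mathbf P=\tilde{\mathbf P}\Gamma$ on $\mathbb C_{13}$ with $\tilde{\mathbf P}$ holomorphic and invertible on all of $\mathbb C_{13}$, and $\Gamma\,\mathbf P_-^{-1}$ extends to a holomorphic and everywhere invertible function on $\mathbb C_{24}$. Then there are vectors $|v_i^{[j]}\rangle\in\mathbb C^2$ ($1\le i\le r$, $0\le j\le n_i-1$),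 uniquely determined by the limits (with $\langle v_i^{[j]}|=|v_i^{[j]}\rangle^\dagger$) $$|v_i^{[j]}\rangle=\lim_{\delta\to0}\frac{\big(\Gamma_i^{[j-1]}\cdots\Gamma_i^{[0]}\;\Gamma_{i-1}^{[n_{i-1}-1]}\cdots\Gamma_{i-1}^{[0]}\cdots\Gamma_1^{[n_1-1]}\cdots\Gamma_1^{[0]}\big)(\zeta_i+\delta)}{\delta^j}\,|v_i\rangle(\zeta_i+\delta),$$ $$\langle v_i^{[j]}|=\lim_{\delta\to0}\langle v_i|(\zeta_i^*+\delta)\,\frac{\big((\Gamma_1^{[0]})^{-1}\cdots(\Gamma_1^{[n_1-1]})^{-1}\cdots(\Gamma_{i}^{[0]})^{-1}\cdots(\Gamma_i^{[j-1]})^{-1}\big)(\zeta_i^*+\delta)}{\delta^j},$$ which all exist, where $$\Gamma_i^{[j]}(\zeta)=I+\frac{A_i^{[j]}}{\zeta-\zeta_i^*}-\frac{\sigma_3A_i^{[j]}\sigma_3}{\zeta+\zeta_i^*},\qquad (\Gamma_i^{[j]})^{-1}(\zeta)=I+\frac{A_i^{[j]\dagger}}{\zeta-\zeta_i}-\frac{\sigma_3A_i^{[j]\dagger}\sigma_3}{\zeta+\zeta_i},$$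 $$A_i^{[j]}=\frac{\zeta_i^{*2}-\zeta_i^2}{2}\begin{pmatrix}\alpha_i^{[j]*}&0\\0&\alpha_i^{[j]}\end{pmatrix}|v_i^{[j]}\rangle\langle v_i^{[j]}|,\qquad (\alpha_i^{[j]})^{-1}=\langle v_i^{[j]}|\begin{pmatrix}\zeta_i&0\\0&\zeta_i^*\end{pmatrix}|v_i^{[j]}\rangle\neq0,$$ the second formula indeed giving the inverse of $\Gamma_i^{[j]}(\zeta)$ for $\zeta\ne\pm\zeta_i,\pm\zeta_i^*$. Moreover there is exactly one dressing matrix (as a function off the points $\pm\zeta_i^*$), and it is the ordered product of these $N$ factors, $$\Gamma(\zeta)=\Gamma_r^{[n_r-1]}\cdots\Gamma_r^{[0]}\cdots\Gamma_1^{[n_1-1]}\cdots\Gamma_1^{[0]},$$ with inverse, off the points $\pm\zeta_i,\pm\zeta_i^*$, the reverse product $$\Gamma^{-1}(\zeta)=(\Gamma_1^{[0]})^{-1}\cdots(\Gamma_1^{[n_1-1]})^{-1}\cdots(\Gamma_r^{[0]})^{-1}\cdots(\Gamma_r^{[n_r-1]})^{-1}.$$ -/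

import Mathlib

open Filter Topology Asymptotics Matrix

noncomputable section

namespace KN

/-- `2 × 2` complex matrices. -/
abbrev M2 := Matrix (Fin 2) (Fin 2) ℂ

/-- Column vectors `|v⟩` in `ℂ²`; the bra `⟨v|` is `star v`. -/
abbrev V2 := Fin 2 → ℂ

/-- The third Pauli matrix. -/
def σ3 : M2 := !![1, 0; 0, -1]

/-- The union of the open first and third quadrants. -/
def C13 : Set ℂ := {ζ | 0 < ζ.re * ζ.im}

/-- The union of the open second and fourth quadrants. -/
def C24 : Set ℂ := {ζ | ζ.re * ζ.im < 0}

/-- A matrix function is holomorphic on `S` when all its entries are. -/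
def HolomorphicOn (F : ℂ → M2) (S : Set ℂ) : Prop :=
  ∀ a b, DifferentiableOn ℂ (fun ζ => F ζ a b) S

/-- The points `±z₁, …, ±zᵣ`. -/
def pts {r : ℕ} (z : Fin r → ℂ) : Set ℂ := {ζ | ∃ i, ζ = z i ∨ ζ = -z i}

/-- The points `±z₁*, …, ±zᵣ*`. -/
def conjPts {r : ℕ} (z : Fin r → ℂ) : Set ℂ := {ζ | ∃ i, ζ = star (z i) ∨ ζ = -star (z i)}

/-- The two sectionally holomorphic functions of the non-regular matrix Riemann–Hilbert problem:
`P` stands for `P₊` on `C13` and `R` for `(P₋)⁻¹` on `C24`.  They satisfy the two symmetry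
reductions, and the zeros of `det P` in `C13` are exactly the `±zᵢ`, of multiplicity `nᵢ`. -/
structure IsNonregularPair {r : ℕ} (z : Fin r → ℂ) (n : Fin r → ℕ) (P R : ℂ → M2) : Prop where
  holo_pos : HolomorphicOn P C13
  holo_neg : HolomorphicOn R C24
  /-- `P(ζ*)† = P⁻¹(ζ)`: here `R = (P₋)⁻¹`. -/
  symm_conj : ∀ ζ ∈ C24, R ζ = (P (star ζ))ᴴ
  /-- `P(-ζ) = σ₃ P(ζ) σ₃`. -/
  symm_neg : ∀ ζ ∈ C13, P (-ζ) = σ3 * P ζ * σ3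
  det_eq : ∃ ρ : ℂ → ℂ, DifferentiableOn ℂ ρ C13 ∧ (∀ ζ ∈ C13, ρ ζ ≠ 0) ∧
    ∀ ζ ∈ C13, (P ζ).det = (∏ i, (ζ ^ 2 - z i ^ 2) ^ n i) * ρ ζ

/-- `v` is a kernel function of `P` at `z` to order `m`: it is analytic at `z`, does not vanish
there, and `P(ζ)|v⟩(ζ) = O((ζ - z)^m)`.  For `m = 1` this says that `|v⟩(z)` is a non-zero
vector in the kernel of `P(z)`. -/
structure IsKernelFunction (P : ℂ → M2) (z : ℂ) (m : ℕ) (v : ℂ → V2) : Prop where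
  analytic : AnalyticAt ℂ v z
  ne_zero : v z ≠ 0
  vanish : (fun ζ => P ζ *ᵥ v ζ) =O[𝓝 z] fun ζ => (ζ - z) ^ m

/-- `Γ` is a dressing matrix of `(P, R) = (P₊, (P₋)⁻¹)`: it is holomorphic off the points `±zᵢ*`,
tends to `I` at infinity, has the symmetries of `P` and the determinant
`∏ ((ζ² - zᵢ²)/(ζ² - zᵢ*²))^{nᵢ}`, and removes all zeros: `P = P̃ Γ`, with
`P̃₊` and `(P̃₋)⁻¹ = Γ (P₋)⁻¹` holomorphic and invertible on `C13` and on `C24`. -/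
structure IsDressingMatrix {r : ℕ} (z : Fin r → ℂ) (n : Fin r → ℕ) (P R Γ : ℂ → M2) : Prop where
  holo : HolomorphicOn Γ (conjPts z)ᶜ
  at_infty : Tendsto Γ (cocompact ℂ) (𝓝 1)
  symm_conj : ∀ ζ, ζ ∉ pts z → ζ ∉ conjPts z → Γ ζ * (Γ (star ζ))ᴴ = 1
  symm_neg : ∀ ζ, ζ ∉ conjPts z → Γ (-ζ) = σ3 * Γ ζ * σ3
  det_eq : ∀ ζ, ζ ∉ conjPts z →
    (Γ ζ).det = ∏ i, ((ζ ^ 2 - z i ^ 2) / (ζ ^ 2 - star (z i) ^ 2)) ^ n i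
  regular_pos : ∃ P' : ℂ → M2, HolomorphicOn P' C13 ∧ (∀ ζ ∈ C13, (P' ζ).det ≠ 0) ∧
    ∀ ζ ∈ C13, P ζ = P' ζ * Γ ζ
  regular_neg : ∃ R' : ℂ → M2, HolomorphicOn R' C24 ∧ (∀ ζ ∈ C24, (R' ζ).det ≠ 0) ∧
    ∀ ζ ∈ C24, ζ ∉ conjPts z → R' ζ = Γ ζ * R ζ

/-- `⟨w| diag(z, z*) |w⟩`, the reciprocal of `α`. -/
def bracket (z : ℂ) (w : V2) : ℂ := star w ⬝ᵥ (diagonal ![z, star z] *ᵥ w)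

/-- `α = ⟨w| diag(z, z*) |w⟩⁻¹`. -/
def alpha (z : ℂ) (w : V2) : ℂ := (bracket z w)⁻¹

/-- `A = (z*² - z²)/2 · diag(α*, α) |w⟩⟨w|`. -/
def coeffA (z : ℂ) (w : V2) : M2 :=
  ((star z ^ 2 - z ^ 2) / 2) •
    (diagonal ![star (alpha z w), alpha z w] * vecMulVec w (star w))

/-- The elementary factor `I + A/(ζ - z*) - σ₃Aσ₃/(ζ + z*)`. -/
def factor (z : ℂ) (w : V2) (ζ : ℂ) : M2 :=
  1 + (ζ - star z)⁻¹ • coeffA z w - (ζ + star z)⁻¹ • (σ3 * coeffA z w * σ3)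

/-- `I + A†/(ζ - z) - σ₃A†σ₃/(ζ + z)`. -/
def factorInv (z : ℂ) (w : V2) (ζ : ℂ) : M2 :=
  1 + (ζ - z)⁻¹ • (coeffA z w)ᴴ - (ζ + z)⁻¹ • (σ3 * (coeffA z w)ᴴ * σ3)

/-- `Γ^{[k-1]} ⋯ Γ^{[1]} Γ^{[0]}` at one zero `z`, with vectors `w 0, w 1, …`. -/
def block (z : ℂ) (w : ℕ → V2) (k : ℕ) (ζ : ℂ) : M2 :=
  ((List.range k).map fun j => factor z (w j) ζ).reverse.prod

/-- `(Γ^{[0]})⁻¹ (Γ^{[1]})⁻¹ ⋯ (Γ^{[k-1]})⁻¹`, from the explicit inverse factors. -/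
def blockInv (z : ℂ) (w : ℕ → V2) (k : ℕ) (ζ : ℂ) : M2 :=
  ((List.range k).map fun j => factorInv z (w j) ζ).prod

/-- The product of the first `m` blocks,
`Γ_m^{[n_m-1]} ⋯ Γ_m^{[0]} ⋯ Γ_1^{[n_1-1]} ⋯ Γ_1^{[0]}`. -/
def blocks {r : ℕ} (z : Fin r → ℂ) (n : Fin r → ℕ) (w : Fin r → ℕ → V2) (m : ℕ) (ζ : ℂ) : M2 :=
  (((List.finRange r).take m).map fun i => block (z i) (w i) (n i) ζ).reverse.prod

/-- The reverse product of the first `m` blocks of explicit inverse factors. -/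
def blocksInv {r : ℕ} (z : Fin r → ℂ) (n : Fin r → ℕ) (w : Fin r → ℕ → V2) (m : ℕ) (ζ : ℂ) : M2 :=
  (((List.finRange r).take m).map fun i => blockInv (z i) (w i) (n i) ζ).prod

/-- The vectors `w i j = |v_i^{[j]}⟩`, `j < nᵢ`, and their bras are the limits, as `δ → 0`, of the
partial products that precede the factor `(i, j)`, applied to `|v_i⟩(zᵢ + δ)` and to
`⟨v_i|(zᵢ* + δ)`, and divided by `δ^j`.  Here `⟨v_i|(λ) = (|v_i⟩(λ*))†`. The index `i : Fin r`
counts from `0`, so that `blocks z n w i` contains exactly the zeros before `zᵢ`. -/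
structure IsLimitChain {r : ℕ} (z : Fin r → ℂ) (n : Fin r → ℕ) (v : Fin r → ℂ → V2)
    (w : Fin r → ℕ → V2) : Prop where
  ket : ∀ i, ∀ j < n i, Tendsto
    (fun δ : ℂ => (δ ^ j)⁻¹ •
      ((block (z i) (w i) j (z i + δ) * blocks z n w i (z i + δ)) *ᵥ v i (z i + δ)))
    (𝓝[≠] 0) (𝓝 (w i j))
  bra : ∀ i, ∀ j < n i, Tendsto
    (fun δ : ℂ => (δ ^ j)⁻¹ •
      (star (v i (star (star (z i) + δ))) ᵥ*
        (blocksInv z n w i (star (z i) + δ) * blockInv (z i) (w i) j (star (z i) + δ))))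
    (𝓝[≠] 0) (𝓝 (star (w i j)))

end KN

end

/-! The factor with vector `w` at `z` has determinant (ζ² - z²)/(ζ² - z*²) and annihilates `w` at
`z`, hence, by the symmetry under ζ ↦ -ζ, also σ₃w at -z. It thus carries exactly one pair of simple
zeros. If a holomorphic matrix annihilates the same two vectors at ±z, the poles of its product with
the inverse factor cancel, and the factor splits off on the right (`exists_eq_mul_factor`).

For a multiple zero, apply the factor with vector v(z) to the kernel function v and divide by ζ - z.
The new vector function is analytic and again non-zero at z (`reduce_ne_zero`), because the inverse
factor has only a simple pole there. It is a kernel function of the remaining left factor, to order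
one less. The recursion therefore never stalls, and its values at z are the limits in the theorem.
Different zeros do not interfere, since a factor is invertible away from its own four points. Once
all N factors are split off (`exists_eq_mul_blocks`), the zeros of det P are used up and the left
factor is invertible (`det_left_factor_ne_zero`).

Uniqueness is Liouville's theorem: the two regularity conditions remove all singularities of Γ₁Γ₂⁻¹,
which tends to I at infinity. -/

namespace KN

/-! ### Algebra of a single elementary factor -/

/-- The explicit entries of an elementary factor, for any matrix coefficient. -/
theorem one_add_smul_sub_smul_conj (A : M2) (s t : ℂ) :
    (1 : M2) + s • A - t • (σ3 * A * σ3) =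
      !![1 + (s - t) * A 0 0, (s + t) * A 0 1; (s + t) * A 1 0, 1 + (s - t) * A 1 1] := by
  ext a b
  fin_cases a <;> fin_cases b <;>
    simp [σ3, Matrix.mul_apply, Fin.sum_univ_two, Matrix.vecMul, dotProduct] <;> ring

theorem σ3_mul_self : σ3 * σ3 = 1 := by
  ext a b
  fin_cases a <;> fin_cases b <;> simp [σ3]

theorem σ3_conjTranspose : σ3ᴴ = σ3 := by
  ext a b
  fin_cases a <;> fin_cases b <;> simp [σ3]

theorem bracket_eq (z : ℂ) (w : V2) :
    bracket z w = star (w 0) * z * w 0 + star (w 1) * star z * w 1 := by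
  simp [bracket, dotProduct, mulVec_diagonal, Fin.sum_univ_two, mul_assoc]

theorem star_bracket_eq (z : ℂ) (w : V2) :
    star (bracket z w) = star (w 0) * star z * w 0 + star (w 1) * z * w 1 := by
  rw [bracket_eq]
  simp only [star_add, star_mul', star_star]
  ring

theorem coeffA_eq (z : ℂ) (w : V2) :
    coeffA z w = ((star z ^ 2 - z ^ 2) / 2) •
      !![(star (bracket z w))⁻¹ * w 0 * star (w 0), (star (bracket z w))⁻¹ * w 0 * star (w 1);
        (bracket z w)⁻¹ * w 1 * star (w 0), (bracket z w)⁻¹ * w 1 * star (w 1)] := by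
  ext a b
  fin_cases a <;> fin_cases b <;>
    simp [coeffA, alpha, Matrix.mul_apply, vecMulVec_apply, Fin.sum_univ_two, mul_assoc]

theorem conjTranspose_coeffA_eq (z : ℂ) (w : V2) :
    (coeffA z w)ᴴ = ((z ^ 2 - star z ^ 2) / 2) •
      !![(bracket z w)⁻¹ * w 0 * star (w 0), (star (bracket z w))⁻¹ * w 0 * star (w 1);
        (bracket z w)⁻¹ * w 1 * star (w 0), (star (bracket z w))⁻¹ * w 1 * star (w 1)] := by
  rw [coeffA_eq]
  ext a b
  fin_cases a <;> fin_cases b <;> simp [-mul_eq_mul_right_iff, -mul_eq_mul_left_iff] <;> ring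

theorem factor_neg (z : ℂ) (w : V2) (ζ : ℂ) : factor z w (-ζ) = σ3 * factor z w ζ * σ3 := by
  have h1 : (-ζ - star z)⁻¹ = -(ζ + star z)⁻¹ := by rw [← inv_neg]; congr 1; ring
  have h2 : (-ζ + star z)⁻¹ = -(ζ - star z)⁻¹ := by rw [← inv_neg]; congr 1; ring
  rw [factor, factor, one_add_smul_sub_smul_conj, one_add_smul_sub_smul_conj, h1, h2]
  ext a b
  fin_cases a <;> fin_cases b <;>
    simp [σ3, Matrix.mul_apply, Fin.sum_univ_two,
      -mul_eq_mul_right_iff, -mul_eq_mul_left_iff] <;> ring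

theorem conjTranspose_factor_star (z : ℂ) (w : V2) (ζ : ℂ) :
    (factor z w (star ζ))ᴴ = factorInv z w ζ := by
  simp [factor, factorInv, conjTranspose_sub, conjTranspose_add, conjTranspose_smul,
    conjTranspose_mul, σ3_conjTranspose, Matrix.mul_assoc]

theorem factor_mul_factorInv {z : ℂ} {w : V2} (hw : bracket z w ≠ 0) {ζ : ℂ} (h1 : ζ ≠ z)
    (h2 : ζ ≠ -z) (h3 : ζ ≠ star z) (h4 : ζ ≠ -star z) :
    factor z w ζ * factorInv z w ζ = 1 := by
  have hw' : star (bracket z w) ≠ 0 := star_ne_zero.2 hw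
  have e1 : ζ - z ≠ 0 := sub_ne_zero.2 h1
  have e2 : ζ + z ≠ 0 := by rwa [← sub_neg_eq_add, sub_ne_zero]
  have e3 : ζ - star z ≠ 0 := sub_ne_zero.2 h3
  have e4 : ζ + star z ≠ 0 := by rwa [← sub_neg_eq_add, sub_ne_zero]
  rw [factor, factorInv, one_add_smul_sub_smul_conj, one_add_smul_sub_smul_conj,
    conjTranspose_coeffA_eq, coeffA_eq]
  have hD := bracket_eq z w
  have hE := star_bracket_eq z w
  -- Conjugates become independent variables. `D` and `E` stay opaque while denominators are cleared
  -- and are expanded only afterwards, which leaves a polynomial identity.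
  generalize star (bracket z w) = E at *
  generalize bracket z w = D at *
  generalize star z = z' at *
  generalize star (w 0) = a' at *
  generalize star (w 1) = b' at *
  generalize w 0 = a at *
  generalize w 1 = b at *
  ext i j
  fin_cases i <;> fin_cases j <;> simp [Matrix.mul_apply, Fin.sum_univ_two] <;> field_simp <;> simp only [hD, hE] <;> ring

theorem factorInv_mul_factor {z : ℂ} {w : V2} (hw : bracket z w ≠ 0) {ζ : ℂ} (h1 : ζ ≠ z)
    (h2 : ζ ≠ -z) (h3 : ζ ≠ star z) (h4 : ζ ≠ -star z) :
    factorInv z w ζ * factor z w ζ = 1 :=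
  mul_eq_one_comm.1 (factor_mul_factorInv hw h1 h2 h3 h4)

theorem det_factor {z : ℂ} {w : V2} (hw : bracket z w ≠ 0) {ζ : ℂ}
    (h3 : ζ ≠ star z) (h4 : ζ ≠ -star z) :
    (factor z w ζ).det = (ζ ^ 2 - z ^ 2) / (ζ ^ 2 - star z ^ 2) := by
  have hw' : star (bracket z w) ≠ 0 := star_ne_zero.2 hw
  have e3 : ζ - star z ≠ 0 := sub_ne_zero.2 h3
  have e4 : ζ + star z ≠ 0 := by rwa [← sub_neg_eq_add, sub_ne_zero]
  have e5 : ζ ^ 2 - star z ^ 2 ≠ 0 := by rw [sq_sub_sq]; exact mul_ne_zero e4 e3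
  rw [factor, one_add_smul_sub_smul_conj, coeffA_eq]
  have hD := bracket_eq z w
  have hE := star_bracket_eq z w
  generalize star (bracket z w) = E at *
  generalize bracket z w = D at *
  generalize star z = z' at *
  generalize star (w 0) = a' at *
  generalize star (w 1) = b' at *
  generalize w 0 = a at *
  generalize w 1 = b at *
  simp [det_fin_two_of]
  field_simp
  simp only [hD, hE]
  ring

/-- This fixes the normalization `alpha`: the two components of the product are w₀(1 - E/E) and w₁(1
- D/D), with D the bracket and E its conjugate. -/
theorem factor_mulVec_self {z : ℂ} {w : V2} (hw : bracket z w ≠ 0) (h3 : z ≠ star z)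
    (h4 : z ≠ -star z) : factor z w z *ᵥ w = 0 := by
  have hw' : star (bracket z w) ≠ 0 := star_ne_zero.2 hw
  have e3 : z - star z ≠ 0 := sub_ne_zero.2 h3
  have e4 : z + star z ≠ 0 := by rwa [← sub_neg_eq_add, sub_ne_zero]
  rw [factor, one_add_smul_sub_smul_conj, coeffA_eq]
  have hD := bracket_eq z w
  have hE := star_bracket_eq z w
  generalize star (bracket z w) = E at *
  generalize bracket z w = D at *
  generalize star z = z' at *
  generalize star (w 0) = a' at *
  generalize star (w 1) = b' at *
  ext i
  fin_cases i <;> simp [Matrix.mulVec, dotProduct, Fin.sum_univ_two] <;> field_simp <;> simp only [hD, hE] <;> ring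

/-- The range of A† lies in the span of `w`. Since A† is the residue of the inverse factor at `z`,
this is what cancels poles in `exists_eq_mul_factor`. -/
theorem mul_conjTranspose_coeffA_eq_zero {z : ℂ} {w : V2} {Q : M2} (h : Q *ᵥ w = 0) :
    Q * (coeffA z w)ᴴ = 0 := by
  rw [coeffA, conjTranspose_smul, conjTranspose_mul, conjTranspose_vecMulVec, star_star,
    mul_smul_comm, ← Matrix.mul_assoc, mul_vecMulVec, h]
  simp

/-- The real part of the bracket is Re z · ‖w‖², and Re z ≠ 0 inside the quadrants. -/
theorem bracket_ne_zero {z : ℂ} (hz : z ∈ C13) {w : V2} (hw : w ≠ 0) : bracket z w ≠ 0 := by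
  intro h
  have hre : z.re ≠ 0 := by
    rintro h0
    simp [C13, h0] at hz
  have : (bracket z w).re = z.re * (Complex.normSq (w 0) + Complex.normSq (w 1)) := by
    rw [bracket_eq]
    simp [Complex.normSq_apply]
    ring
  rw [h, Complex.zero_re, eq_comm, mul_eq_zero, or_iff_right hre] at this
  have h0 := Complex.normSq_nonneg (w 0)
  have h1 := Complex.normSq_nonneg (w 1)
  refine hw (funext fun i => ?_)
  fin_cases i
  · exact Complex.normSq_eq_zero.1 (le_antisymm (by simpa using by linarith) h0)
  · exact Complex.normSq_eq_zero.1 (le_antisymm (by simpa using by linarith) h1)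

/-! ### Products of factors -/

@[simp] theorem block_zero (z : ℂ) (w : ℕ → V2) (ζ : ℂ) : block z w 0 ζ = 1 := by
  simp [block]

@[simp] theorem blockInv_zero (z : ℂ) (w : ℕ → V2) (ζ : ℂ) : blockInv z w 0 ζ = 1 := by
  simp [blockInv]

theorem block_succ (z : ℂ) (w : ℕ → V2) (k : ℕ) (ζ : ℂ) :
    block z w (k + 1) ζ = factor z (w k) ζ * block z w k ζ := by
  simp [block, List.range_succ]

theorem blockInv_succ (z : ℂ) (w : ℕ → V2) (k : ℕ) (ζ : ℂ) :
    blockInv z w (k + 1) ζ = blockInv z w k ζ * factorInv z (w k) ζ := by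
  simp [blockInv, List.range_succ]

section

variable {r : ℕ} (z : Fin r → ℂ) (n : Fin r → ℕ) (w : Fin r → ℕ → V2)

@[simp] theorem blocks_zero (ζ : ℂ) : blocks z n w 0 ζ = 1 := by
  simp [blocks]

@[simp] theorem blocksInv_zero (ζ : ℂ) : blocksInv z n w 0 ζ = 1 := by
  simp [blocksInv]

theorem take_finRange_succ (i : Fin r) :
    (List.finRange r).take (i + 1) = (List.finRange r).take i ++ [i] := by
  simp [List.take_add_one]

theorem blocks_succ (i : Fin r) (ζ : ℂ) :
    blocks z n w (i + 1) ζ = block (z i) (w i) (n i) ζ * blocks z n w i ζ := by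
  simp [blocks, take_finRange_succ]

theorem blocksInv_succ (i : Fin r) (ζ : ℂ) :
    blocksInv z n w (i + 1) ζ = blocksInv z n w i ζ * blockInv (z i) (w i) (n i) ζ := by
  simp [blocksInv, take_finRange_succ]

end

theorem block_congr {z : ℂ} {w w' : ℕ → V2} {k : ℕ} (h : ∀ j < k, w j = w' j) :
    block z w k = block z w' k := by
  funext ζ
  induction k with
  | zero => simp
  | succ k ih =>
    rw [block_succ, block_succ, ih fun j hj => h j (hj.trans k.lt_succ_self), h k k.lt_succ_self]

theorem blocks_congr {r : ℕ} {z : Fin r → ℂ} {n : Fin r → ℕ} {w w' : Fin r → ℕ → V2} {m : ℕ}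
    (hm : m ≤ r) (h : ∀ i : Fin r, (i : ℕ) < m → ∀ j < n i, w i j = w' i j) :
    blocks z n w m = blocks z n w' m := by
  funext ζ
  induction m with
  | zero => simp
  | succ m ih =>
    -- `hm : m + 1 ≤ r` is by definition `m < r`, so `⟨m, hm⟩` is the index of the last block.
    have e := blocks_succ z n w ⟨m, hm⟩ ζ
    have e' := blocks_succ z n w' ⟨m, hm⟩ ζ
    rw [e, e', block_congr (h ⟨m, hm⟩ m.lt_succ_self)]
    exact congrArg _ (ih (Nat.le_of_lt hm) fun i hi => h i (hi.trans m.lt_succ_self))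

/-- Induction along the ordered product, one elementary factor at a time. -/
theorem blocks_induction {r : ℕ} {z : Fin r → ℂ} {n : Fin r → ℕ} {w : Fin r → ℕ → V2}
    {p : (ℂ → M2) → Prop} {m : ℕ} (hm : m ≤ r) (one : p fun _ => 1)
    (step : ∀ i : Fin r, (i : ℕ) < m → ∀ j < n i,
      p (fun ζ => block (z i) (w i) j ζ * blocks z n w i ζ) →
      p (fun ζ => factor (z i) (w i j) ζ * (block (z i) (w i) j ζ * blocks z n w i ζ))) :
    p (blocks z n w m) := by
  induction m with
  | zero => simpa [funext (blocks_zero z n w)] using one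
  | succ m ih =>
    have ih := ih (Nat.le_of_lt hm) fun i hi => step i (hi.trans m.lt_succ_self)
    have key : ∀ j ≤ n ⟨m, hm⟩,
        p (fun ζ => block (z ⟨m, hm⟩) (w ⟨m, hm⟩) j ζ * blocks z n w m ζ) := by
      intro j
      induction j with
      | zero => intro _; simpa using ih
      | succ j ihj =>
        intro hj
        simp only [block_succ, Matrix.mul_assoc]
        exact step ⟨m, hm⟩ m.lt_succ_self j hj (ihj (Nat.le_of_lt hj))
    have e : blocks z n w (m + 1) = _ := funext (blocks_succ z n w ⟨m, hm⟩)
    rw [e]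
    exact key _ le_rfl

/-- Through this symmetry, the limits of the bras reduce to those of the kets and the inverse of the
product is its conjugate transpose at ζ*. -/
theorem conjTranspose_block_star (z : ℂ) (w : ℕ → V2) (k : ℕ) (ζ : ℂ) :
    (block z w k (star ζ))ᴴ = blockInv z w k ζ := by
  induction k with
  | zero => simp
  | succ k ih =>
    rw [block_succ, blockInv_succ, conjTranspose_mul, ih, conjTranspose_factor_star]

theorem conjTranspose_blocks_star {r : ℕ} (z : Fin r → ℂ) (n : Fin r → ℕ) (w : Fin r → ℕ → V2)
    {m : ℕ} (hm : m ≤ r) (ζ : ℂ) :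
    (blocks z n w m (star ζ))ᴴ = blocksInv z n w m ζ := by
  induction m with
  | zero => simp
  | succ m ih =>
    have e := blocks_succ z n w ⟨m, hm⟩ (star ζ)
    have e' := blocksInv_succ z n w ⟨m, hm⟩ ζ
    rw [e, e', conjTranspose_mul, conjTranspose_block_star]
    exact congrArg (· * _) (ih (Nat.le_of_lt hm))

/-! ### Holomorphic matrix functions -/

theorem isOpen_C13 : IsOpen C13 :=
  isOpen_lt continuous_const (Complex.continuous_re.mul Complex.continuous_im)

theorem isOpen_C24 : IsOpen C24 :=
  isOpen_lt (Complex.continuous_re.mul Complex.continuous_im) continuous_const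

theorem neg_mem_C13 {ζ : ℂ} : -ζ ∈ C13 ↔ ζ ∈ C13 := by simp [C13]

theorem star_mem_C13 {ζ : ℂ} : star ζ ∈ C13 ↔ ζ ∈ C24 := by simp [C13, C24]

theorem ne_of_mem_C13_of_mem_C24 {a b : ℂ} (ha : a ∈ C13) (hb : b ∈ C24) : a ≠ b := by
  rintro rfl
  exact lt_asymm (show 0 < a.re * a.im from ha) hb

theorem star_mem_C24 {ζ : ℂ} : star ζ ∈ C24 ↔ ζ ∈ C13 := by simp [C13, C24]

theorem neg_mem_C24 {ζ : ℂ} : -ζ ∈ C24 ↔ ζ ∈ C24 := by simp [C24]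

section

variable {F G : ℂ → M2} {S : Set ℂ}

theorem holomorphicOn_const (A : M2) : HolomorphicOn (fun _ => A) S :=
  fun _ _ => differentiableOn_const _

theorem HolomorphicOn.mul (hF : HolomorphicOn F S) (hG : HolomorphicOn G S) :
    HolomorphicOn (fun ζ => F ζ * G ζ) S := by
  intro a b
  simp only [Matrix.mul_apply, Fin.sum_univ_two]
  exact ((hF a 0).mul (hG 0 b)).add ((hF a 1).mul (hG 1 b))

theorem HolomorphicOn.mono {T : Set ℂ} (hF : HolomorphicOn F S) (h : T ⊆ S) :
    HolomorphicOn F T := fun a b => (hF a b).mono h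

theorem HolomorphicOn.congr (hF : HolomorphicOn F S) (h : ∀ ζ ∈ S, G ζ = F ζ) :
    HolomorphicOn G S := fun a b => (hF a b).congr fun ζ hζ => by rw [h ζ hζ]

theorem HolomorphicOn.det (hF : HolomorphicOn F S) :
    DifferentiableOn ℂ (fun ζ => (F ζ).det) S := by
  simp only [det_fin_two]
  exact ((hF 0 0).mul (hF 1 1)).sub ((hF 0 1).mul (hF 1 0))

theorem HolomorphicOn.inv (hF : HolomorphicOn F S) (h : ∀ ζ ∈ S, (F ζ).det ≠ 0) :
    HolomorphicOn (fun ζ => (F ζ)⁻¹) S := by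
  have hd : DifferentiableOn ℂ (fun ζ => ((F ζ).det)⁻¹) S := hF.det.inv h
  intro a b
  simp only [Matrix.inv_def, Ring.inverse_eq_inv', adjugate_fin_two, Matrix.smul_apply, smul_eq_mul]
  refine hd.mul ?_
  fin_cases a <;> fin_cases b
  · simpa using hF 1 1
  · simpa using hF 0 1
  · simpa using hF 1 0
  · simpa using hF 0 0

theorem HolomorphicOn.continuousOn (hF : HolomorphicOn F S) : ContinuousOn F S :=
  continuousOn_pi.2 fun a => continuousOn_pi.2 fun b => (hF a b).continuousOn

theorem HolomorphicOn.continuousAt (hF : HolomorphicOn F S) {ζ : ℂ} (hS : S ∈ 𝓝 ζ) :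
    ContinuousAt F ζ :=
  hF.continuousOn.continuousAt hS

theorem HolomorphicOn.analyticAt_mulVec (hF : HolomorphicOn F S) {ζ : ℂ} (hS : S ∈ 𝓝 ζ)
    {v : ℂ → V2} (hv : AnalyticAt ℂ v ζ) : AnalyticAt ℂ (fun ξ => F ξ *ᵥ v ξ) ζ := by
  have hv' := analyticAt_pi_iff.1 hv
  refine analyticAt_pi_iff.2 fun a => ?_
  simp only [mulVec, dotProduct, Fin.sum_univ_two]
  exact (((hF a 0).analyticAt hS).mul (hv' 0)).add (((hF a 1).analyticAt hS).mul (hv' 1))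

end

theorem holomorphicOn_factor (z : ℂ) (w : V2) :
    HolomorphicOn (factor z w) {ζ | ζ ≠ star z ∧ ζ ≠ -star z} := by
  intro a b
  have h1 : DifferentiableOn ℂ (fun ζ : ℂ => (ζ - star z)⁻¹)
      {ζ | ζ ≠ star z ∧ ζ ≠ -star z} :=
    (differentiableOn_id.sub_const _).inv fun ζ h => sub_ne_zero.2 h.1
  have h2 : DifferentiableOn ℂ (fun ζ : ℂ => (ζ + star z)⁻¹)
      {ζ | ζ ≠ star z ∧ ζ ≠ -star z} :=
    (differentiableOn_id.add_const _).inv fun ζ h => fun h0 => h.2 (eq_neg_of_add_eq_zero_left h0)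
  simp only [factor, Matrix.sub_apply, Matrix.add_apply, Matrix.smul_apply, smul_eq_mul]
  exact ((differentiableOn_const _).add (h1.mul_const _)).sub (h2.mul_const _)

theorem tendsto_factor_cocompact (z : ℂ) (w : V2) :
    Tendsto (factor z w) (cocompact ℂ) (𝓝 1) := by
  have h : ∀ c : ℂ, Tendsto (fun ζ : ℂ => (ζ + c)⁻¹) (cocompact ℂ) (𝓝 0) := fun c =>
    tendsto_inv₀_cobounded.comp
      (by simpa [Metric.cobounded_eq_cocompact] using
        (Homeomorph.addRight c).isClosedEmbedding.tendsto_cocompact)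
  have h1 := (h (-star z)).smul_const (coeffA z w)
  have h2 := (h (star z)).smul_const (σ3 * coeffA z w * σ3)
  have := (h1.const_add 1).sub h2
  rw [zero_smul, zero_smul, add_zero, sub_zero] at this
  exact this.congr fun ζ => by simp only [factor, sub_eq_add_neg]

/-! ### The chain of vectors at one zero -/

theorem _root_.AnalyticAt.dslope_self {E : Type*} [NormedAddCommGroup E] [NormedSpace ℂ E]
    {f : ℂ → E} {z : ℂ} (hf : AnalyticAt ℂ f z) : AnalyticAt ℂ (dslope f z) z := by
  obtain ⟨p, hp⟩ := hf
  exact ⟨_, hp.has_fpower_series_dslope_fslope⟩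

theorem continuousAt_mulVec {F : ℂ → M2} {v : ℂ → V2} {ζ : ℂ} (hF : ContinuousAt F ζ)
    (hv : ContinuousAt v ζ) : ContinuousAt (fun ξ => F ξ *ᵥ v ξ) ζ :=
  have h : Continuous fun p : M2 × V2 => p.1 *ᵥ p.2 := continuous_fst.matrix_mulVec continuous_snd
  ContinuousAt.comp' (g := fun p : M2 × V2 => p.1 *ᵥ p.2) (f := fun ξ => (F ξ, v ξ))
    h.continuousAt (hF.prodMk hv)

theorem ne_star_of_mem {a b : ℂ} (ha : a ∈ C13) (hb : b ∈ C13) : a ≠ star b :=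
  ne_of_mem_C13_of_mem_C24 ha (star_mem_C24.2 hb)

theorem ne_neg_star_of_mem {a b : ℂ} (ha : a ∈ C13) (hb : b ∈ C13) : a ≠ -star b :=
  ne_of_mem_C13_of_mem_C24 ha (neg_mem_C24.2 (star_mem_C24.2 hb))

theorem ne_neg_of_mem {a : ℂ} (ha : a ∈ C13) : a ≠ -a := by
  intro h
  have : a = 0 := by linear_combination h / 2
  simp [this, C13] at ha

theorem setOf_ne_mem_nhds {a b c : ℂ} (h : c ≠ a) (h' : c ≠ b) :
    {ζ : ℂ | ζ ≠ a ∧ ζ ≠ b} ∈ 𝓝 c :=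
  (isOpen_ne.inter isOpen_ne).mem_nhds ⟨h, h'⟩

/-- Applying the elementary factor with vector `u z` to `u` and dividing by `ζ - z`. -/
noncomputable def reduce (z : ℂ) (u : ℂ → V2) : ℂ → V2 :=
  dslope (fun ζ => factor z (u z) ζ *ᵥ u ζ) z

section

variable {z : ℂ} {u : ℂ → V2}

theorem analyticAt_factor_mulVec (hz : z ∈ C13) (w : V2) (hu : AnalyticAt ℂ u z) :
    AnalyticAt ℂ (fun ζ => factor z w ζ *ᵥ u ζ) z :=
  (holomorphicOn_factor z w).analyticAt_mulVec
    (setOf_ne_mem_nhds (ne_star_of_mem hz hz) (ne_neg_star_of_mem hz hz)) hu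

theorem analyticAt_reduce (hz : z ∈ C13) (hu : AnalyticAt ℂ u z) :
    AnalyticAt ℂ (reduce z u) z :=
  (analyticAt_factor_mulVec hz _ hu).dslope_self

theorem factor_mulVec_eq_smul_reduce (hz : z ∈ C13) (h0 : u z ≠ 0) (ζ : ℂ) :
    factor z (u z) ζ *ᵥ u ζ = (ζ - z) • reduce z u ζ := by
  rw [reduce, sub_smul_dslope, factor_mulVec_self (bracket_ne_zero hz h0) (ne_star_of_mem hz hz)
    (ne_neg_star_of_mem hz hz), sub_zero]

/-- Undoing the division gives u = (ζ - z) · factorInv · reduce u away from z. The matrix (ζ - z) ·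
factorInv is bounded near z, so if `reduce z u` vanished at z, so would u. -/
theorem reduce_ne_zero (hz : z ∈ C13) (hu : AnalyticAt ℂ u z) (h0 : u z ≠ 0) :
    reduce z u z ≠ 0 := by
  intro h
  set A := coeffA z (u z) with hA
  -- The matrix is (ζ - z) · factorInv with its pole at z cancelled by hand, hence continuous there.
  have hlim : Tendsto (fun ζ => ((ζ - z) • (1 : M2) + Aᴴ - ((ζ - z) * (ζ + z)⁻¹) • (σ3 * Aᴴ * σ3)) *ᵥ
      reduce z u ζ) (𝓝[≠] z) (𝓝 0) := by
    have hc : ContinuousAt (fun ζ => ((ζ - z) • (1 : M2) + Aᴴ -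
        ((ζ - z) * (ζ + z)⁻¹) • (σ3 * Aᴴ * σ3)) *ᵥ reduce z u ζ) z := by
      have h1 : ContinuousAt (fun ζ : ℂ => ζ - z) z := by fun_prop
      have h2 : ContinuousAt (fun ζ : ℂ => (ζ + z)⁻¹) z := by
        refine ContinuousAt.inv₀ (by fun_prop) fun h => ne_neg_of_mem hz ?_
        exact eq_neg_of_add_eq_zero_left h
      exact continuousAt_mulVec
        (((h1.smul continuousAt_const).add continuousAt_const).sub
          ((h1.mul h2).smul continuousAt_const)) (analyticAt_reduce hz hu).continuousAt
    have := hc.tendsto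
    simp only [h, mulVec_zero] at this
    exact this.mono_left nhdsWithin_le_nhds
  have hu' : Tendsto u (𝓝[≠] z) (𝓝 (u z)) := hu.continuousAt.tendsto.mono_left nhdsWithin_le_nhds
  refine h0 (tendsto_nhds_unique (hu'.congr' ?_) hlim)
  have hne : {ζ : ℂ | ζ ≠ star z ∧ ζ ≠ -star z} ∩ {ζ : ℂ | ζ ≠ -z ∧ ζ ≠ -z} ∈ 𝓝 z :=
    inter_mem (setOf_ne_mem_nhds (ne_star_of_mem hz hz) (ne_neg_star_of_mem hz hz))
      (setOf_ne_mem_nhds (ne_neg_of_mem hz) (ne_neg_of_mem hz))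
  filter_upwards [self_mem_nhdsWithin, mem_nhdsWithin_of_mem_nhds hne] with ζ h1 h2
  have hsub : ζ - z ≠ 0 := sub_ne_zero.2 h1
  have hinv := factorInv_mul_factor (bracket_ne_zero hz h0) h1 h2.2.1 h2.1.1 h2.1.2
  calc u ζ = factorInv z (u z) ζ *ᵥ (factor z (u z) ζ *ᵥ u ζ) := by
        rw [mulVec_mulVec, hinv, one_mulVec]
    _ = ((ζ - z) • factorInv z (u z) ζ) *ᵥ reduce z u ζ := by
        rw [factor_mulVec_eq_smul_reduce hz h0, mulVec_smul, smul_mulVec]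
    _ = _ := by
        rw [factorInv, smul_sub, smul_add, smul_smul, smul_smul, mul_inv_cancel₀ hsub, one_smul]

theorem analyticAt_iterate_reduce (hz : z ∈ C13) (hu : AnalyticAt ℂ u z) (h0 : u z ≠ 0) (k : ℕ) :
    AnalyticAt ℂ ((reduce z)^[k] u) z ∧ (reduce z)^[k] u z ≠ 0 := by
  induction k with
  | zero => exact ⟨hu, h0⟩
  | succ k ih =>
    rw [Function.iterate_succ_apply']
    exact ⟨analyticAt_reduce hz ih.1, reduce_ne_zero hz ih.1 ih.2⟩

theorem block_mulVec_eq (hz : z ∈ C13) (hu : AnalyticAt ℂ u z) (h0 : u z ≠ 0) (k : ℕ) (ζ : ℂ) :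
    block z (fun j => (reduce z)^[j] u z) k ζ *ᵥ u ζ = (ζ - z) ^ k • (reduce z)^[k] u ζ := by
  induction k with
  | zero => simp
  | succ k ih =>
    rw [block_succ, ← mulVec_mulVec, ih, mulVec_smul,
      factor_mulVec_eq_smul_reduce hz (analyticAt_iterate_reduce hz hu h0 k).2, smul_smul, pow_succ,
      Function.iterate_succ_apply']

end

/-! ### The chain of vectors at all zeros -/

section

variable {r : ℕ} {z : Fin r → ℂ} {n : Fin r → ℕ}

theorem conjPts_subset_C24 (hz : ∀ i, z i ∈ C13) : conjPts z ⊆ C24 := by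
  rintro ζ ⟨i, rfl | rfl⟩
  · exact star_mem_C24.2 (hz i)
  · exact neg_mem_C24.2 (star_mem_C24.2 (hz i))

theorem pts_subset_C13 (hz : ∀ i, z i ∈ C13) : pts z ⊆ C13 := by
  rintro ζ ⟨i, rfl | rfl⟩
  · exact hz i
  · exact neg_mem_C13.2 (hz i)

theorem finite_pts : (pts z).Finite := by
  refine ((Set.finite_range z).union (Set.finite_range fun i => -z i)).subset ?_
  rintro ζ ⟨i, h | h⟩
  · exact .inl ⟨i, h.symm⟩
  · exact .inr ⟨i, h.symm⟩

theorem finite_conjPts : (conjPts z).Finite := by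
  refine ((Set.finite_range fun i => star (z i)).union
    (Set.finite_range fun i => -star (z i))).subset ?_
  rintro ζ ⟨i, h | h⟩
  · exact .inl ⟨i, h.symm⟩
  · exact .inr ⟨i, h.symm⟩

theorem isOpen_compl_conjPts : IsOpen (conjPts z)ᶜ := finite_conjPts.isClosed.isOpen_compl

theorem isOpen_compl_pts : IsOpen (pts z)ᶜ := finite_pts.isClosed.isOpen_compl

theorem ne_of_notMem_conjPts {ζ : ℂ} (h : ζ ∉ conjPts z) (i : Fin r) :
    ζ ≠ star (z i) ∧ ζ ≠ -star (z i) :=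
  ⟨fun e => h ⟨i, .inl e⟩, fun e => h ⟨i, .inr e⟩⟩

theorem ne_of_notMem_pts {ζ : ℂ} (h : ζ ∉ pts z) (i : Fin r) : ζ ≠ z i ∧ ζ ≠ -z i :=
  ⟨fun e => h ⟨i, .inl e⟩, fun e => h ⟨i, .inr e⟩⟩

theorem holomorphicOn_blocks (w : Fin r → ℕ → V2) {m : ℕ} (hm : m ≤ r) :
    HolomorphicOn (blocks z n w m) (conjPts z)ᶜ :=
  blocks_induction (p := fun G => HolomorphicOn G (conjPts z)ᶜ) hm (holomorphicOn_const 1)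
    fun i _ j _ hG =>
      ((holomorphicOn_factor (z i) (w i j)).mono fun _ h => ne_of_notMem_conjPts h i).mul hG

/-- Away from the zeros that occur in it, the partial product is invertible. -/
theorem isUnit_blocks {w : Fin r → ℕ → V2} {m : ℕ} (hm : m ≤ r) {ζ : ℂ}
    (hw : ∀ i : Fin r, (i : ℕ) < m → ∀ j < n i, bracket (z i) (w i j) ≠ 0)
    (h1 : ∀ i : Fin r, (i : ℕ) < m → ζ ≠ z i ∧ ζ ≠ -z i) (h2 : ζ ∉ conjPts z) :
    IsUnit (blocks z n w m ζ) :=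
  blocks_induction (p := fun G => IsUnit (G ζ)) hm isUnit_one fun i hi j hj hG =>
    have h := ne_of_notMem_conjPts h2 i
    IsUnit.mul (IsUnit.of_mul_eq_one _
      (factor_mul_factorInv (hw i hi j hj) (h1 i hi).1 (h1 i hi).2 h.1 h.2)) hG

/-- At `z i`, the partial product in front of the factor `(i, j)`, applied to `v i`, is
`(ζ - z i) ^ j` times a function that is continuous at `z i` and takes there the non-zero value
`w i j`. -/
def IsReducedChainAt (z : Fin r → ℂ) (n : Fin r → ℕ) (v : Fin r → ℂ → V2) (w : Fin r → ℕ → V2)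
    (i : Fin r) (j : ℕ) : Prop :=
  w i j ≠ 0 ∧ ∃ U : ℂ → V2, ContinuousAt U (z i) ∧ U (z i) = w i j ∧
    ∀ ζ, (block (z i) (w i) j ζ * blocks z n w i ζ) *ᵥ v i ζ = (ζ - z i) ^ j • U ζ

/-- The zeros are treated in order: the earlier blocks turn `v i` into a vector function to which
the one-zero recursion applies. The chain is built for all `j`; `P` and the bound `j < n i` play no
role yet. -/
theorem exists_reducedChain (hz : ∀ i, z i ∈ C13)
    (hdist : ∀ i k, i ≠ k → z i ≠ z k ∧ z i ≠ -z k) {v : Fin r → ℂ → V2}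
    (hv : ∀ i, AnalyticAt ℂ (v i) (z i)) (hv0 : ∀ i, v i (z i) ≠ 0) :
    ∃ w : Fin r → ℕ → V2, ∀ i j, IsReducedChainAt z n v w i j := by
  have key : ∀ m ≤ r, ∃ w : Fin r → ℕ → V2, ∀ i : Fin r, (i : ℕ) < m →
      ∀ j, IsReducedChainAt z n v w i j := by
    intro m
    induction m with
    | zero => exact fun _ => ⟨0, fun i hi => absurd hi (Nat.not_lt_zero _)⟩
    | succ m ih =>
      intro hm
      obtain ⟨w, hw⟩ := ih (Nat.le_of_lt hm)
      let a : Fin r := ⟨m, hm⟩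
      let u : ℂ → V2 := fun ζ => blocks z n w m ζ *ᵥ v a ζ
      let w' := Function.update w a fun j => (reduce (z a))^[j] u (z a)
      have ha : z a ∉ conjPts z := fun h =>
        ne_of_mem_C13_of_mem_C24 (hz a) (conjPts_subset_C24 hz h) rfl
      have hu : AnalyticAt ℂ u (z a) :=
        (holomorphicOn_blocks w (Nat.le_of_lt hm)).analyticAt_mulVec
          (isOpen_compl_conjPts.mem_nhds ha) (hv a)
      have hu0 : u (z a) ≠ 0 := by
        -- The earlier factors degenerate only at ± their own zeros, which differ from `z a`, and
        -- their poles lie in the other quadrants.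
        have hunit : IsUnit (blocks z n w m (z a)) := by
          refine isUnit_blocks (Nat.le_of_lt hm)
            (fun i hi j _ => bracket_ne_zero (hz i) (hw i hi j).1) (fun i hi => ?_) ha
          exact hdist a i fun e => hi.ne (by rw [← e])
        intro h
        refine hv0 a (mulVec_injective_of_isUnit hunit ?_)
        simpa [u] using h
      have hww' : ∀ i : Fin r, (i : ℕ) < m → w' i = w i := fun i hi =>
        Function.update_of_ne (fun e => hi.ne (by rw [e])) _ _
      have hbl : ∀ k ≤ m, blocks z n w' k = blocks z n w k := fun k hk =>
        blocks_congr (hk.trans (Nat.le_of_lt hm)) fun i hi j _ => by rw [hww' i (hi.trans_le hk)]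
      have hwa : w' a = fun j => (reduce (z a))^[j] u (z a) := Function.update_self _ _ _
      refine ⟨w', fun i hi j => ?_⟩
      rcases Nat.lt_succ_iff_lt_or_eq.1 hi with hi | hi
      · rw [IsReducedChainAt, hww' i hi, hbl i hi.le]
        exact hw i hi j
      · obtain rfl : i = a := Fin.ext hi
        have h := analyticAt_iterate_reduce (hz a) hu hu0 j
        rw [IsReducedChainAt, hwa, hbl _ hi.le]
        refine ⟨h.2, _, h.1.continuousAt, rfl, fun ζ => ?_⟩
        rw [← mulVec_mulVec]
        exact block_mulVec_eq (hz a) hu hu0 j ζ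
  obtain ⟨w, hw⟩ := key r le_rfl
  exact ⟨w, fun i j => hw i i.2 j⟩

theorem tendsto_const_add_nhdsNE (a : ℂ) : Tendsto (fun δ => a + δ) (𝓝[≠] 0) (𝓝[≠] a) := by
  refine tendsto_nhdsWithin_iff.2 ⟨?_, ?_⟩
  · have : Tendsto (fun δ => a + δ) (𝓝 0) (𝓝 (a + 0)) :=
      (continuous_const.add continuous_id).tendsto 0
    rw [add_zero] at this
    exact this.mono_left nhdsWithin_le_nhds
  · filter_upwards [self_mem_nhdsWithin] with δ hδ
    simpa using hδ

theorem IsReducedChainAt.tendsto {v : Fin r → ℂ → V2} {w : Fin r → ℕ → V2} {i : Fin r} {j : ℕ}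
    (h : IsReducedChainAt z n v w i j) :
    Tendsto (fun δ : ℂ => (δ ^ j)⁻¹ •
      ((block (z i) (w i) j (z i + δ) * blocks z n w i (z i + δ)) *ᵥ v i (z i + δ)))
    (𝓝[≠] 0) (𝓝 (w i j)) := by
  obtain ⟨-, U, hU, hU0, heq⟩ := h
  rw [← hU0]
  have := (hU.tendsto.mono_left nhdsWithin_le_nhds).comp (tendsto_const_add_nhdsNE (z i))
  refine this.congr' ?_
  filter_upwards [self_mem_nhdsWithin] with δ hδ
  rw [heq, add_sub_cancel_left, smul_smul, inv_mul_cancel₀ (pow_ne_zero _ hδ), one_smul]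
  rfl

/-- The bra limit is the conjugate transpose of the ket limit, with δ replaced by δ*. -/
theorem isLimitChain_of_reducedChain {v : Fin r → ℂ → V2} {w : Fin r → ℕ → V2}
    (h : ∀ i j, IsReducedChainAt z n v w i j) : IsLimitChain z n v w where
  ket i j _ := (h i j).tendsto
  bra i j _ := by
    have hstar : Tendsto (star : ℂ → ℂ) (𝓝[≠] 0) (𝓝[≠] 0) := by
      refine tendsto_nhdsWithin_iff.2 ⟨?_, ?_⟩
      · have : Tendsto (star : ℂ → ℂ) (𝓝 0) (𝓝 (star 0)) := continuous_star.tendsto 0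
        rw [star_zero] at this
        exact this.mono_left nhdsWithin_le_nhds
      · filter_upwards [self_mem_nhdsWithin] with δ hδ
        simpa using hδ
    have := (continuous_star.tendsto (w i j)).comp ((h i j).tendsto.comp hstar)
    refine this.congr fun δ => ?_
    simp only [Function.comp_apply]
    have e : star (star (z i) + δ) = z i + star δ := by rw [star_add, star_star]
    rw [star_smul, star_mulVec, conjTranspose_mul, e, ← star_star (z i + star δ),
      conjTranspose_block_star, conjTranspose_blocks_star z n w i.2.le, star_add, star_star,
      star_add, star_star, star_inv₀, star_pow, star_star]

/-- The ket limit at (i, j) involves only vectors earlier in lexicographic order, so induction on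
that order and uniqueness of limits suffice. -/
theorem IsLimitChain.unique {v : Fin r → ℂ → V2} {w w' : Fin r → ℕ → V2}
    (h : IsLimitChain z n v w) (h' : IsLimitChain z n v w') :
    ∀ i, ∀ j < n i, w' i j = w i j := by
  intro i
  induction i using WellFoundedLT.induction with
  | ind i ih =>
    intro j
    induction j using Nat.strong_induction_on with
    | _ j ihj =>
      intro hj
      have e1 : blocks z n w' i = blocks z n w i := blocks_congr i.2.le fun k hk => ih k hk
      have e2 : block (z i) (w' i) j = block (z i) (w i) j :=
        block_congr fun k hk => ihj k hk (hk.trans hj)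
      have h2 := h'.ket i j hj
      rw [e1, e2] at h2
      exact tendsto_nhds_unique h2 (h.ket i j hj)

end

/-! ### Removal of the zeros -/

section

variable {r : ℕ} {z : Fin r → ℂ} {n : Fin r → ℕ} {w : Fin r → ℕ → V2}

theorem blocks_mul_blocksInv {m : ℕ} (hm : m ≤ r)
    (hw : ∀ i, ∀ j < n i, bracket (z i) (w i j) ≠ 0) {ζ : ℂ}
    (h1 : ζ ∉ pts z) (h2 : ζ ∉ conjPts z) :
    blocks z n w m ζ * blocksInv z n w m ζ = 1 := by
  rw [← conjTranspose_blocks_star z n w hm]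
  -- In the form G(ζ)G(ζ*)† = 1 the claim involves a single product and survives multiplication by a
  -- factor on the left.
  refine blocks_induction (p := fun G => G ζ * (G (star ζ))ᴴ = 1) hm (by simp) ?_
  intro i _ j hj hG
  have h3 := ne_of_notMem_pts h1 i
  have h4 := ne_of_notMem_conjPts h2 i
  simp only at hG ⊢
  generalize block (z i) (w i) j ζ * blocks z n w i ζ = G at *
  generalize block (z i) (w i) j (star ζ) * blocks z n w i (star ζ) = G' at *
  rw [conjTranspose_mul, conjTranspose_factor_star, Matrix.mul_assoc, ← Matrix.mul_assoc G, hG,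
    Matrix.one_mul, factor_mul_factorInv (hw i j hj) h3.1 h3.2 h4.1 h4.2]

theorem σ3_conj_mul (A B : M2) : σ3 * A * σ3 * (σ3 * B * σ3) = σ3 * (A * B) * σ3 := by
  calc _ = σ3 * A * (σ3 * σ3) * B * σ3 := by simp only [Matrix.mul_assoc]
    _ = _ := by rw [σ3_mul_self, Matrix.mul_one, ← Matrix.mul_assoc σ3]

theorem block_neg (a : ℂ) (u : ℕ → V2) (k : ℕ) (ζ : ℂ) :
    block a u k (-ζ) = σ3 * block a u k ζ * σ3 := by
  induction k with
  | zero => simp [σ3_mul_self]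
  | succ k ih => rw [block_succ, block_succ, ih, factor_neg, σ3_conj_mul]

theorem blocks_neg (w : Fin r → ℕ → V2) {m : ℕ} (hm : m ≤ r) (ζ : ℂ) :
    blocks z n w m (-ζ) = σ3 * blocks z n w m ζ * σ3 := by
  refine blocks_induction (p := fun G => G (-ζ) = σ3 * G ζ * σ3) hm
    (by simp [σ3_mul_self]) ?_
  intro i _ j _ hG
  simp only at hG ⊢
  rw [hG, factor_neg, σ3_conj_mul]

theorem tendsto_blocks_cocompact (w : Fin r → ℕ → V2) {m : ℕ} (hm : m ≤ r) :
    Tendsto (blocks z n w m) (cocompact ℂ) (𝓝 1) := by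
  refine blocks_induction (p := fun G => Tendsto G (cocompact ℂ) (𝓝 1)) hm tendsto_const_nhds ?_
  intro i _ j _ hG
  simpa using (tendsto_factor_cocompact (z i) (w i j)).mul hG

theorem det_block {a : ℂ} {u : ℕ → V2} {k : ℕ} (hu : ∀ j < k, bracket a (u j) ≠ 0) {ζ : ℂ}
    (h : ζ ≠ star a ∧ ζ ≠ -star a) :
    (block a u k ζ).det = ((ζ ^ 2 - a ^ 2) / (ζ ^ 2 - star a ^ 2)) ^ k := by
  induction k with
  | zero => simp
  | succ k ih =>
    rw [block_succ, det_mul, ih fun j hj => hu j (hj.trans k.lt_succ_self),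
      det_factor (hu k k.lt_succ_self) h.1 h.2]
    exact (pow_succ' _ _).symm

theorem det_blocks (hw : ∀ i, ∀ j < n i, bracket (z i) (w i j) ≠ 0) {ζ : ℂ}
    (h : ζ ∉ conjPts z) :
    (blocks z n w r ζ).det = ∏ i, ((ζ ^ 2 - z i ^ 2) / (ζ ^ 2 - star (z i) ^ 2)) ^ n i := by
  -- Determinants commute, so the reversal of the list disappears.
  have e : (blocks z n w r ζ).det =
      (((List.finRange r).map fun i => block (z i) (w i) (n i) ζ).map Matrix.det).prod := by
    rw [blocks, List.take_of_length_le (by simp), ← coe_detMonoidHom, ← map_list_prod,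
      ← MulOpposite.unop_op (detMonoidHom _), ← MulOpposite.unop_op (detMonoidHom _)]
    simp [map_list_prod, List.map_reverse, List.prod_reverse]
  rw [e, List.map_map, ← List.ofFn_eq_map, List.prod_ofFn]
  exact Finset.prod_congr rfl fun i _ => det_block (hw i) (ne_of_notMem_conjPts h i)

/-- A matrix function that annihilates `w` at `z` and `σ₃ w` at `-z` is divisible on the right by
the elementary factor with vector `w`. -/
theorem exists_eq_mul_factor {a : ℂ} (ha : a ∈ C13) {u : V2} (hu : bracket a u ≠ 0) {Q : ℂ → M2}
    (hQ : HolomorphicOn Q C13) (h1 : Q a *ᵥ u = 0) (h2 : (Q (-a) * σ3) *ᵥ u = 0) :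
    ∃ Q' : ℂ → M2, HolomorphicOn Q' C13 ∧ ∀ ζ ∈ C13, Q ζ = Q' ζ * factor a u ζ := by
  let f : ℂ → M2 := fun ζ => Q ζ * (coeffA a u)ᴴ
  let g : ℂ → M2 := fun ζ => Q ζ * (σ3 * (coeffA a u)ᴴ * σ3)
  have hf : HolomorphicOn f C13 := hQ.mul (holomorphicOn_const _)
  have hg : HolomorphicOn g C13 := hQ.mul (holomorphicOn_const _)
  have hfa : f a = 0 := mul_conjTranspose_coeffA_eq_zero h1
  have hga : g (-a) = 0 := by
    simp only [g, ← Matrix.mul_assoc]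
    rw [mul_conjTranspose_coeffA_eq_zero h2, Matrix.zero_mul]
  -- Off ±a this is Q · factorInv = Q + f/(ζ - a) - g/(ζ + a). As f(a) = 0 and g(-a) = 0, the
  -- divided differences extend both quotients holomorphically.
  let Q' : ℂ → M2 := fun ζ => Q ζ + (Matrix.of fun i j => dslope (fun ξ => f ξ i j) a ζ) -
    (Matrix.of fun i j => dslope (fun ξ => g ξ i j) (-a) ζ)
  have hQ' : HolomorphicOn Q' C13 := by
    intro i j
    have hf' := (Complex.differentiableOn_dslope (isOpen_C13.mem_nhds ha)).2 (hf i j)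
    have hg' := (Complex.differentiableOn_dslope
      (isOpen_C13.mem_nhds (neg_mem_C13.2 ha))).2 (hg i j)
    exact ((hQ i j).add hf').sub hg'
  have hoff : ∀ ζ, ζ ≠ a → ζ ≠ -a → Q' ζ = Q ζ * factorInv a u ζ := by
    intro ζ h3 h4
    have ef : (Matrix.of fun i j => dslope (fun ξ => f ξ i j) a ζ) = (ζ - a)⁻¹ • f ζ := by
      ext i j
      simp [dslope_of_ne _ h3, slope_def_field, hfa, div_eq_inv_mul]
    have eg : (Matrix.of fun i j => dslope (fun ξ => g ξ i j) (-a) ζ) = (ζ + a)⁻¹ • g ζ := by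
      ext i j
      simp [dslope_of_ne _ h4, slope_def_field, hga, div_eq_inv_mul]
    simp only [Q', ef, eg, f, g, factorInv, Matrix.mul_sub, Matrix.mul_add, Matrix.mul_smul,
      Matrix.mul_one]
  refine ⟨Q', hQ', fun ζ hζ => ?_⟩
  have hfac : HolomorphicOn (factor a u) C13 := (holomorphicOn_factor a u).mono fun ξ hξ =>
    ⟨ne_star_of_mem hξ ha, ne_neg_star_of_mem hξ ha⟩
  -- The factorization is algebraic off ±a and passes to ±a by continuity.
  have hev : ∀ᶠ ξ in 𝓝[≠] ζ, Q ξ = Q' ξ * factor a u ξ := by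
    have hfin : ({a, -a} : Set ℂ)ᶜ ∈ 𝓝[≠] ζ := by
      have := (Set.toFinite ({a, -a} \ {ζ} : Set ℂ)).isClosed.isOpen_compl.mem_nhds
        (show ζ ∈ ({a, -a} \ {ζ} : Set ℂ)ᶜ from fun h => h.2 rfl)
      filter_upwards [self_mem_nhdsWithin, mem_nhdsWithin_of_mem_nhds this] with ξ h3 h4 h5
      exact h4 ⟨h5, h3⟩
    filter_upwards [hfin, mem_nhdsWithin_of_mem_nhds (isOpen_C13.mem_nhds hζ)] with ξ h3 h4
    have h5 : ξ ≠ a := fun e => h3 (.inl e)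
    have h6 : ξ ≠ -a := fun e => h3 (.inr e)
    rw [hoff ξ h5 h6, Matrix.mul_assoc, factorInv_mul_factor hu h5 h6 (ne_star_of_mem h4 ha)
      (ne_neg_star_of_mem h4 ha), Matrix.mul_one]
  have hc := (hQ'.mul hfac).continuousAt (isOpen_C13.mem_nhds hζ)
  have hc' := hQ.continuousAt (isOpen_C13.mem_nhds hζ)
  exact tendsto_nhds_unique (hc'.tendsto.mono_left nhdsWithin_le_nhds)
    ((hc.tendsto.mono_left nhdsWithin_le_nhds).congr' (hev.mono fun _ h => h.symm))

/-- If `B U` vanishes at `a` to an order greater than that of the scalar in `(ζ - a)^j U`, the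
value of `B` at `a` annihilates that of `U`. -/
theorem mulVec_eq_zero_of_isBigO {a : ℂ} {j k : ℕ} (hjk : j < k) {B : ℂ → M2} {U : ℂ → V2}
    (hB : ContinuousAt B a) (hU : ContinuousAt U a)
    (h : (fun ζ => (ζ - a) ^ j • (B ζ *ᵥ U ζ)) =O[𝓝 a] fun ζ => (ζ - a) ^ k) :
    B a *ᵥ U a = 0 := by
  have h1 : Tendsto (fun ζ => B ζ *ᵥ U ζ) (𝓝[≠] a) (𝓝 (B a *ᵥ U a)) :=
    (continuousAt_mulVec hB hU).tendsto.mono_left nhdsWithin_le_nhds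
  have h2 : (fun ζ => B ζ *ᵥ U ζ) =O[𝓝[≠] a] fun ζ => (ζ - a) ^ (k - j) := by
    have h3 : (fun ζ => ((ζ - a) ^ j)⁻¹) =O[𝓝[≠] a] fun ζ => ((ζ - a) ^ j)⁻¹ := isBigO_refl _ _
    refine (h3.smul (h.mono nhdsWithin_le_nhds)).congr' ?_ ?_
    · filter_upwards [self_mem_nhdsWithin] with ζ hζ
      rw [smul_smul, inv_mul_cancel₀ (pow_ne_zero _ (sub_ne_zero.2 hζ)), one_smul]
    · filter_upwards [self_mem_nhdsWithin] with ζ hζ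
      rw [smul_eq_mul, pow_sub₀ _ (sub_ne_zero.2 hζ) hjk.le, mul_comm]
  refine tendsto_nhds_unique h1 (h2.trans_tendsto ?_)
  have : ContinuousAt (fun ζ : ℂ => (ζ - a) ^ (k - j)) a := by fun_prop
  have h4 := this.tendsto.mono_left (nhdsWithin_le_nhds (s := {a}ᶜ))
  rwa [sub_self, zero_pow (Nat.sub_ne_zero_of_lt hjk)] at h4

/-- Suppose P = QG with G the partial product before (i, j). Since G vᵢ = (ζ - zᵢ)^j U and P vᵢ =
O((ζ - zᵢ)^nᵢ) with j < nᵢ, the matrix Q(zᵢ) annihilates U(zᵢ) = `w i j`, and the next factor splits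
off from Q. -/
theorem exists_eq_mul_blocks (hz : ∀ i, z i ∈ C13) {P : ℂ → M2} (hP : HolomorphicOn P C13)
    (hsymm : ∀ ζ ∈ C13, P (-ζ) = σ3 * P ζ * σ3) {v : Fin r → ℂ → V2}
    (hv : ∀ i, (fun ζ => P ζ *ᵥ v i ζ) =O[𝓝 (z i)] fun ζ => (ζ - z i) ^ n i)
    (hw : ∀ i j, IsReducedChainAt z n v w i j) :
    ∃ P' : ℂ → M2, HolomorphicOn P' C13 ∧ ∀ ζ ∈ C13, P ζ = P' ζ * blocks z n w r ζ := by
  refine blocks_induction (p := fun G => ∃ Q : ℂ → M2, HolomorphicOn Q C13 ∧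
    ∀ ζ ∈ C13, P ζ = Q ζ * G ζ) le_rfl ⟨P, hP, fun ζ _ => (Matrix.mul_one _).symm⟩ ?_
  rintro i - j hj ⟨Q, hQ, hPQ⟩
  simp only at hPQ
  obtain ⟨hw0, U, hU, hU0, heq⟩ := hw i j
  have hneg : ∀ ζ, block (z i) (w i) j (-ζ) * blocks z n w i (-ζ) =
      σ3 * (block (z i) (w i) j ζ * blocks z n w i ζ) * σ3 := fun ζ => by
    rw [block_neg, blocks_neg w i.2.le, σ3_conj_mul]
  have h1 : Q (z i) *ᵥ w i j = 0 := by
    rw [← hU0]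
    refine mulVec_eq_zero_of_isBigO hj (hQ.continuousAt (isOpen_C13.mem_nhds (hz i))) hU
      ((hv i).congr' ?_ EventuallyEq.rfl)
    filter_upwards [isOpen_C13.mem_nhds (hz i)] with ζ hζ
    rw [hPQ ζ hζ, ← mulVec_mulVec, heq, mulVec_smul]
  -- At -zᵢ the same argument runs with Q(-ζ)σ₃, because σ₃P(ζ) = P(-ζ)σ₃ = Q(-ζ)σ₃G(ζ).
  have h2 : (Q (-z i) * σ3) *ᵥ w i j = 0 := by
    rw [← hU0]
    have hc : ContinuousAt (fun ζ => Q (-ζ) * σ3) (z i) :=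
      ContinuousAt.mul (ContinuousAt.comp' (hQ.continuousAt
        (isOpen_C13.mem_nhds (neg_mem_C13.2 (hz i)))) continuous_neg.continuousAt) continuousAt_const
    refine mulVec_eq_zero_of_isBigO (B := fun ζ => Q (-ζ) * σ3) hj hc hU ?_
    have hσ : (fun ζ => σ3 *ᵥ (P ζ *ᵥ v i ζ)) =O[𝓝 (z i)] fun ζ => P ζ *ᵥ v i ζ :=
      (LinearMap.toContinuousLinearMap (Matrix.mulVecLin σ3)).isBigO_comp _ _
    refine (hσ.trans (hv i)).congr' ?_ EventuallyEq.rfl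
    filter_upwards [isOpen_C13.mem_nhds (hz i)] with ζ hζ
    have e1 : σ3 * P ζ = P (-ζ) * σ3 := by
      rw [hsymm ζ hζ, Matrix.mul_assoc, σ3_mul_self, Matrix.mul_one]
    rw [← mulVec_smul, ← heq, mulVec_mulVec, mulVec_mulVec, e1, hPQ _ (neg_mem_C13.2 hζ), hneg]
    congr 1
    simp only [Matrix.mul_assoc, σ3_mul_self, Matrix.mul_one]
  obtain ⟨Q', hQ', h⟩ := exists_eq_mul_factor (hz i) (bracket_ne_zero (hz i) hw0) hQ h1 h2
  refine ⟨Q', hQ', fun ζ hζ => ?_⟩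
  rw [hPQ ζ hζ, h ζ hζ, Matrix.mul_assoc]

end

/-! ### The ordered product is the dressing matrix -/

theorem eq_of_eventuallyEq_nhdsNE {X : Type*} [TopologicalSpace X] [T2Space X] {f g : ℂ → X} {a : ℂ}
    (hf : ContinuousAt f a) (hg : ContinuousAt g a) (h : ∀ᶠ ζ in 𝓝[≠] a, f ζ = g ζ) : f a = g a :=
  tendsto_nhds_unique (hf.tendsto.mono_left nhdsWithin_le_nhds)
    ((hg.tendsto.mono_left nhdsWithin_le_nhds).congr' (h.mono fun _ e => e.symm))

theorem _root_.Set.Finite.eventually_nhdsNE_notMem {s : Set ℂ} (hs : s.Finite) (a : ℂ) :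
    ∀ᶠ ζ in 𝓝[≠] a, ζ ∉ s := by
  have := (hs.sdiff (t := {a})).isClosed.isOpen_compl.mem_nhds
    (show a ∈ (s \ {a})ᶜ from fun h => h.2 rfl)
  filter_upwards [self_mem_nhdsWithin, mem_nhdsWithin_of_mem_nhds this] with ζ h1 h2 h3
  exact h2 ⟨h3, h1⟩

section

variable {r : ℕ} {z : Fin r → ℂ} {n : Fin r → ℕ}

theorem sq_sub_sq_ne_zero {ζ a : ℂ} (h : ζ ≠ a ∧ ζ ≠ -a) : ζ ^ 2 - a ^ 2 ≠ 0 := by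
  rw [sq_sub_sq]
  exact mul_ne_zero (fun e => h.2 (eq_neg_of_add_eq_zero_left e)) (sub_ne_zero.2 h.1)

/-- The left factor of a factorization of `P` has no zeros if its right factor carries all of the
zeros of `det P`. -/
theorem det_left_factor_ne_zero (hz : ∀ i, z i ∈ C13) {P P' Γ : ℂ → M2}
    (hdet : ∃ ρ : ℂ → ℂ, DifferentiableOn ℂ ρ C13 ∧ (∀ ζ ∈ C13, ρ ζ ≠ 0) ∧
      ∀ ζ ∈ C13, (P ζ).det = (∏ i, (ζ ^ 2 - z i ^ 2) ^ n i) * ρ ζ)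
    (hΓ : ∀ ζ, ζ ∉ conjPts z →
      (Γ ζ).det = ∏ i, ((ζ ^ 2 - z i ^ 2) / (ζ ^ 2 - star (z i) ^ 2)) ^ n i)
    (hP' : HolomorphicOn P' C13) (h : ∀ ζ ∈ C13, P ζ = P' ζ * Γ ζ) :
    ∀ ζ ∈ C13, (P' ζ).det ≠ 0 := by
  obtain ⟨ρ, hρ, hρ0, hPdet⟩ := hdet
  have hconj : ∀ ζ ∈ C13, ζ ∉ conjPts z := fun ζ hζ h' =>
    ne_of_mem_C13_of_mem_C24 hζ (conjPts_subset_C24 hz h') rfl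
  have hoff : ∀ ζ ∈ C13, ζ ∉ pts z →
      (P' ζ).det = (∏ i, (ζ ^ 2 - star (z i) ^ 2) ^ n i) * ρ ζ := by
    intro ζ hζ hpt
    have h1 : (∏ i, (ζ ^ 2 - z i ^ 2) ^ n i) ≠ 0 :=
      Finset.prod_ne_zero_iff.2 fun i _ => pow_ne_zero _ (sq_sub_sq_ne_zero (ne_of_notMem_pts hpt i))
    have h2 : (∏ i, (ζ ^ 2 - star (z i) ^ 2) ^ n i) ≠ 0 :=
      Finset.prod_ne_zero_iff.2 fun i _ =>
        pow_ne_zero _ (sq_sub_sq_ne_zero (ne_of_notMem_conjPts (hconj ζ hζ) i))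
    have e := hPdet ζ hζ
    rw [h ζ hζ, det_mul, hΓ ζ (hconj ζ hζ)] at e
    simp only [div_pow, Finset.prod_div_distrib] at e
    field_simp at e
    linear_combination e
  intro ζ hζ
  have hc : ContinuousAt (fun ζ => (P' ζ).det) ζ :=
    (hP'.det.continuousOn).continuousAt (isOpen_C13.mem_nhds hζ)
  have hc' : ContinuousAt (fun ζ => (∏ i, (ζ ^ 2 - star (z i) ^ 2) ^ n i) * ρ ζ) ζ := by
    have := hρ.continuousOn.continuousAt (isOpen_C13.mem_nhds hζ)
    fun_prop
  -- The determinant formula, found off ±zᵢ by cancelling, holds at ±zᵢ by continuity; its right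
  -- side has no zeros in `C13`.
  rw [eq_of_eventuallyEq_nhdsNE hc hc' (by
    filter_upwards [finite_pts.eventually_nhdsNE_notMem ζ,
      mem_nhdsWithin_of_mem_nhds (isOpen_C13.mem_nhds hζ)] with ξ h1 h2 using hoff ξ h2 h1)]
  exact mul_ne_zero (Finset.prod_ne_zero_iff.2 fun i _ =>
    pow_ne_zero _ (sq_sub_sq_ne_zero (ne_of_notMem_conjPts (hconj ζ hζ) i))) (hρ0 ζ hζ)

theorem HolomorphicOn.conjTranspose_star {F : ℂ → M2} (hF : HolomorphicOn F C13) :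
    HolomorphicOn (fun ζ => (F (star ζ))ᴴ) C24 := by
  intro a b ζ hζ
  have h := (hF b a).differentiableAt (isOpen_C13.mem_nhds (star_mem_C13.2 hζ))
  have := h.star_star
  rw [star_star] at this
  exact this.differentiableWithinAt

/-- The condition on `C24` follows from the one on `C13`: R = P(ζ*)† = Γ(ζ*)†P'(ζ*)†, so ΓR =
P'(ζ*)†. -/
theorem isDressingMatrix_blocks (hz : ∀ i, z i ∈ C13) {P R : ℂ → M2}
    (hP : IsNonregularPair z n P R) {v : Fin r → ℂ → V2}
    (hv : ∀ i, (fun ζ => P ζ *ᵥ v i ζ) =O[𝓝 (z i)] fun ζ => (ζ - z i) ^ n i)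
    {w : Fin r → ℕ → V2} (hw : ∀ i j, IsReducedChainAt z n v w i j) :
    IsDressingMatrix z n P R (blocks z n w r) := by
  have hb : ∀ i, ∀ j < n i, bracket (z i) (w i j) ≠ 0 := fun i j _ =>
    bracket_ne_zero (hz i) (hw i j).1
  obtain ⟨P', hP', hPP'⟩ := exists_eq_mul_blocks hz hP.holo_pos hP.symm_neg hv hw
  have hdet' := det_left_factor_ne_zero hz hP.det_eq (fun ζ => det_blocks hb) hP' hPP'
  have hsymm : ∀ ζ, ζ ∉ pts z → ζ ∉ conjPts z →
      blocks z n w r ζ * (blocks z n w r (star ζ))ᴴ = 1 := fun ζ h1 h2 => by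
    rw [conjTranspose_blocks_star z n w le_rfl, blocks_mul_blocksInv le_rfl hb h1 h2]
  refine ⟨holomorphicOn_blocks w le_rfl, tendsto_blocks_cocompact w le_rfl, hsymm,
    fun ζ _ => blocks_neg w le_rfl ζ, fun ζ => det_blocks hb, ⟨P', hP', hdet', hPP'⟩,
    ⟨fun ζ => (P' (star ζ))ᴴ, hP'.conjTranspose_star, fun ζ hζ => ?_, fun ζ hζ hc => ?_⟩⟩
  · rw [det_conjTranspose]
    exact star_ne_zero.2 (hdet' _ (star_mem_C13.2 hζ))
  · have hpt : ζ ∉ pts z := fun h => ne_of_mem_C13_of_mem_C24 (pts_subset_C13 hz h) hζ rfl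
    rw [hP.symm_conj ζ hζ, hPP' _ (star_mem_C13.2 hζ), conjTranspose_mul, ← Matrix.mul_assoc,
      hsymm ζ hpt hc, Matrix.one_mul]

/-- Two dressing matrices of the same pair coincide: their quotient is entire and tends to `1`. -/
theorem IsDressingMatrix.unique (hz : ∀ i, z i ∈ C13) {P R Γ₁ Γ₂ : ℂ → M2}
    (h₁ : IsDressingMatrix z n P R Γ₁)
    (h₂ : IsDressingMatrix z n P R Γ₂) : ∀ ζ, ζ ∉ conjPts z → Γ₁ ζ = Γ₂ ζ := by
  classical
  obtain ⟨P₁, hP₁, hP₁det, hP₁eq⟩ := h₁.regular_pos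
  obtain ⟨P₂, hP₂, -, hP₂eq⟩ := h₂.regular_pos
  obtain ⟨R₁, hR₁, -, hR₁eq⟩ := h₁.regular_neg
  obtain ⟨R₂, hR₂, hR₂det, hR₂eq⟩ := h₂.regular_neg
  have hΓdet : ∀ ζ, ζ ∉ pts z → ζ ∉ conjPts z → (Γ₂ ζ).det ≠ 0 := by
    intro ζ h1 h2
    rw [h₂.det_eq ζ h2]
    exact Finset.prod_ne_zero_iff.2 fun i _ => pow_ne_zero _ (div_ne_zero
      (sq_sub_sq_ne_zero (ne_of_notMem_pts h1 i)) (sq_sub_sq_ne_zero (ne_of_notMem_conjPts h2 i)))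
  let S : Set ℂ := (pts z)ᶜ ∩ (conjPts z)ᶜ
  have hS : IsOpen S := isOpen_compl_pts.inter isOpen_compl_conjPts
  let G₀ : ℂ → M2 := fun ζ => Γ₁ ζ * (Γ₂ ζ)⁻¹
  have hG₀ : HolomorphicOn G₀ S :=
    (h₁.holo.mono Set.inter_subset_right).mul
      ((h₂.holo.mono Set.inter_subset_right).inv fun ζ h => hΓdet ζ h.1 h.2)
  -- Three expressions for Γ₁Γ₂⁻¹: the first is regular at ±zᵢ, the second at ±zᵢ*, and the third
  -- near the axes, which contain none of these points.
  let G : ℂ → M2 := fun ζ =>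
    if ζ ∈ C13 then (P₁ ζ)⁻¹ * P₂ ζ else if ζ ∈ C24 then R₁ ζ * (R₂ ζ)⁻¹ else G₀ ζ
  have hG13 : ∀ ζ ∈ C13, G ζ = (P₁ ζ)⁻¹ * P₂ ζ := fun ζ h => if_pos h
  have hG24 : ∀ ζ ∈ C24, G ζ = R₁ ζ * (R₂ ζ)⁻¹ := fun ζ h => by
    have : ζ ∉ C13 := fun h' => ne_of_mem_C13_of_mem_C24 h' h rfl
    simp only [G, if_neg this, if_pos h]
  have hGS : ∀ ζ ∈ S, G ζ = G₀ ζ := by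
    intro ζ hζ
    have hu := (isUnit_iff_ne_zero.2 (hΓdet ζ hζ.1 hζ.2))
    by_cases h13 : ζ ∈ C13
    · have hu1 := isUnit_iff_ne_zero.2 (hP₁det ζ h13)
      have e : P₂ ζ * Γ₂ ζ = P₁ ζ * Γ₁ ζ := by rw [← hP₁eq ζ h13, hP₂eq ζ h13]
      have e' : P₂ ζ = P₁ ζ * Γ₁ ζ * (Γ₂ ζ)⁻¹ := by rw [← e, mul_nonsing_inv_cancel_right _ _ hu]
      rw [hG13 ζ h13, e', Matrix.mul_assoc, nonsing_inv_mul_cancel_left _ _ hu1]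
    · by_cases h24 : ζ ∈ C24
      · have e1 := hR₁eq ζ h24 hζ.2
        have e2 := hR₂eq ζ h24 hζ.2
        have hu2 := isUnit_iff_ne_zero.2 (hR₂det ζ h24)
        have e3 : R₁ ζ = Γ₁ ζ * (Γ₂ ζ)⁻¹ * R₂ ζ := by
          rw [e1, e2, Matrix.mul_assoc, nonsing_inv_mul_cancel_left _ _ hu]
        rw [hG24 ζ h24, e3, mul_nonsing_inv_cancel_right _ _ hu2]
      · simp only [G, if_neg h13, if_neg h24]
  have hGdiff : ∀ a b, Differentiable ℂ fun ζ => G ζ a b := by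
    intro a b ζ
    by_cases h13 : ζ ∈ C13
    · exact (((hP₁.inv hP₁det).mul hP₂).congr hG13 a b).differentiableAt (isOpen_C13.mem_nhds h13)
    by_cases h24 : ζ ∈ C24
    · exact ((hR₁.mul (hR₂.inv hR₂det)).congr hG24 a b).differentiableAt (isOpen_C24.mem_nhds h24)
    · exact (hG₀.congr hGS a b).differentiableAt (hS.mem_nhds
        ⟨fun h => h13 (pts_subset_C13 hz h), fun h => h24 (conjPts_subset_C24 hz h)⟩)
  have hSinf : ∀ᶠ ζ in cocompact ℂ, ζ ∈ S := by
    filter_upwards [finite_pts.isCompact.compl_mem_cocompact (s := pts z),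
      finite_conjPts.isCompact.compl_mem_cocompact (s := conjPts z)] with ζ h1 h2 using ⟨h1, h2⟩
  have hGinf : Tendsto G (cocompact ℂ) (𝓝 1) := by
    have hinv : Tendsto (fun ζ => (Γ₂ ζ)⁻¹) (cocompact ℂ) (𝓝 1) := by
      have hc : ContinuousAt (fun A : M2 => A⁻¹) 1 := by
        simp only [Matrix.inv_def, Ring.inverse_eq_inv']
        exact (continuous_id.matrix_det.continuousAt.inv₀ (by simp)).smul
          continuous_id.matrix_adjugate.continuousAt
      have := hc.tendsto.comp h₂.at_infty
      rwa [inv_one] at this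
    have := h₁.at_infty.mul hinv
    rw [Matrix.one_mul] at this
    exact this.congr' (hSinf.mono fun ζ h => (hGS ζ h).symm)
  -- Liouville's theorem, applied to each entry.
  have hG1 : ∀ ζ, G ζ = 1 := by
    intro ζ
    ext a b
    exact (hGdiff a b).apply_eq_of_tendsto_cocompact ζ
      (((continuous_id.matrix_elem a b).tendsto (1 : M2)).comp hGinf)
  have hSeq : ∀ ζ ∈ S, Γ₁ ζ = Γ₂ ζ := by
    intro ζ hζ
    have e : Γ₁ ζ * (Γ₂ ζ)⁻¹ = 1 := by rw [← hG1 ζ, hGS ζ hζ]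
    have hu := (isUnit_iff_ne_zero.2 (hΓdet ζ hζ.1 hζ.2))
    rw [← nonsing_inv_mul_cancel_right (Γ₂ ζ) (Γ₁ ζ) hu, e, Matrix.one_mul]
  intro ζ hζ
  have hnhds := isOpen_compl_conjPts.mem_nhds hζ
  -- The points ±zᵢ, where Γ₂ may be singular, are recovered by continuity.
  refine eq_of_eventuallyEq_nhdsNE (h₁.holo.continuousAt hnhds) (h₂.holo.continuousAt hnhds) ?_
  filter_upwards [finite_pts.eventually_nhdsNE_notMem ζ, mem_nhdsWithin_of_mem_nhds hnhds]
    with ξ h1 h2 using hSeq ξ ⟨h1, h2⟩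

end

end KN
-- Assembly of the theorem
theorem mainTheorem2 {r : ℕ} (z : Fin r → ℂ) (n : Fin r → ℕ)
    (hz : ∀ i, z i ∈ KN.C13)
    (hdist : ∀ i k, i ≠ k → z i ≠ z k ∧ z i ≠ -z k)
    (P R : ℂ → KN.M2) (hP : KN.IsNonregularPair z n P R)
    (v : Fin r → ℂ → KN.V2)
    (hv : ∀ i, KN.IsKernelFunction P (z i) (n i) (v i)) :
    ∃ w : Fin r → ℕ → KN.V2,
      -- the limits defining the vectors exist, and they determine the vectors
      KN.IsLimitChain z n v w ∧
      (∀ w' : Fin r → ℕ → KN.V2, KN.IsLimitChain z n v w' → ∀ i, ∀ j < n i, w' i j = w i j) ∧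
      -- the factors are well defined, with the stated inverses
      (∀ i, ∀ j < n i, KN.bracket (z i) (w i j) ≠ 0) ∧
      (∀ i, ∀ j < n i, ∀ ζ : ℂ, ζ ≠ z i → ζ ≠ -z i → ζ ≠ star (z i) → ζ ≠ -star (z i) →
        KN.factor (z i) (w i j) ζ * KN.factorInv (z i) (w i j) ζ = 1 ∧
        KN.factorInv (z i) (w i j) ζ * KN.factor (z i) (w i j) ζ = 1) ∧
      -- the ordered product is a dressing matrix, and every dressing matrix is this product
      KN.IsDressingMatrix z n P R (KN.blocks z n w r) ∧
      (∀ Γ : ℂ → KN.M2, KN.IsDressingMatrix z n P R Γ →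
        ∀ ζ, ζ ∉ KN.conjPts z → Γ ζ = KN.blocks z n w r ζ) ∧
      -- its inverse is the reverse product of the inverse factors
      (∀ ζ, ζ ∉ KN.pts z → ζ ∉ KN.conjPts z →
        KN.blocks z n w r ζ * KN.blocksInv z n w r ζ = 1 ∧
        KN.blocksInv z n w r ζ * KN.blocks z n w r ζ = 1) := by

  obtain ⟨w, hw⟩ := KN.exists_reducedChain (n := n) hz hdist (fun i => (hv i).analytic)
    fun i => (hv i).ne_zero
  have hb : ∀ i, ∀ j < n i, KN.bracket (z i) (w i j) ≠ 0 := fun i j _ =>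
    KN.bracket_ne_zero (hz i) (hw i j).1
  have hchain := KN.isLimitChain_of_reducedChain hw
  have hdress := KN.isDressingMatrix_blocks hz hP (fun i => (hv i).vanish) hw
  refine ⟨w, hchain, fun w' h' => hchain.unique h', hb, fun i j hj ζ h1 h2 h3 h4 =>
    ⟨KN.factor_mul_factorInv (hb i j hj) h1 h2 h3 h4,
      KN.factorInv_mul_factor (hb i j hj) h1 h2 h3 h4⟩, hdress,
    fun Γ hΓ => hΓ.unique hz hdress, fun ζ h1 h2 => ?_⟩
  have h := KN.blocks_mul_blocksInv le_rfl hb h1 h2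
  exact ⟨h, mul_eq_one_comm.1 h⟩
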